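/- Fix a set $C$ of colours. A hypergraph is a finite vertex set $V(G)$ together with a finite set $E(G)$ of edges, each edge being a tuple $(v_1,\dots,v_r;c)$ of $r\ge 2$ distinct vertices with a colour $c\in C$. Isomorphisms preserve the direction and the colour of edges. $G[U]$ is the subhypergraph induced by $U\subseteq V(G)$; $H\le G$ means that $H$ is isomorphic to some $G[U]$. $K_1$ is the one-vertex hypergraph and $kG$ is the disjoint union of $k$ copies of $G$. The $*$-join $G_1*\cdots*G_n$ of hypergraphs with disjoint vertex sets is the set of all hypergraphs $H$ with $V(H)=\bigcup_i V(G_i)$ and $H[V(G_i)]=G_i$ for all $i$; $s\circledast G$ is the $*$-join of $s$ copies $G^1,\dots,G^s$ of $G$. A property is a non-empty isomorphism-closed class of hypergraphs. It is induced-hereditary if it is closed under taking induced subhypergraphs, and additive if it is closed under disjoint unions. Let $\mathcal P$ be an additive induced-hereditary property. A $\mathcal P$-decomposition of $G$ with $n$ parts is an (unordered) partition of $V(G)$ into $n$ non-empty sets $V_1,\dots,V_n$ such that $kG[V_1]*\cdots*kG[V_n]\subseteq\mathcal P$ for every positive integer $k$. For $G\in\mathcal P$, $dec_{\mathcal P}(G)$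 is the maximum number of parts in a $\mathcal P$-decomposition of $G$, and $dec_{\mathcal P}(G)=0$ for $G\notin\mathcal P$. $G$ is $\mathcal P$-strict if $G\in\mathcal P$ but $G*K_1\not\subseteq\mathcal P$. $G$ is uniquely $\mathcal P$-decomposable if it has exactly one $\mathcal P$-decomposition with $dec_{\mathcal P}(G)$ parts. $dec(\mathcal P)$ is the minimum of $dec_{\mathcal P}(G)$ over all $\mathcal P$-strict $G$. (1) Let $G$ be a $\mathcal P$-strict hypergraph with $dec_{\mathcal P}(G)=n$, and let $d_0$ be a $\mathcal P$-decomposition of $G$ with $n$ parts. Then for some $s\ge 1$ there is a $\mathcal P$-strict hypergraph $G^*\in s\circledast G$ which has exactly one $\mathcal P$-decomposition $d$ with $n$ parts, and $d|G^j=d_0$ for every $j=1,\dots,s$, where $d|G^j$ is the partition of the $j$-th copy $G^j$ of $G$ into the non-empty intersections of the parts of $d$ with $V(G^j)$. (2) If moreover $\mathcal P$ is not the class of all hypergraphs, then the class of all $\mathcal P$-strict, uniquely $\mathcal P$-decomposable hypergraphs $G$ with $dec_{\mathcal P}(G)=dec(\mathcal P)$ is a generating set for $\mathcal P$: the smallest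 induced-hereditary property containing this class is $\mathcal P$. -/

import Mathlib

/-- A directed, edge-coloured hypergraph with finitely many edges on the vertex type `V`, with colours in `C`.
An edge is a tuple `(v₁, …, vᵣ; c)` of distinct vertices together with a colour. There are no loops
(edges of size 1), no empty edges, and no multiple edges (the edges form a set). -/
@[ext]
structure DirColHypergraph (C : Type*) (V : Type) where
  edges : Set (List V × C)
  finite_edges : edges.Finite
  nodup : ∀ e ∈ edges, e.1.Nodup
  two_le_length : ∀ e ∈ edges, 2 ≤ e.1.length

/-- A finite hypergraph together with its vertex type. -/
structure FinDirColHypergraph (C : Type*) where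
  V : Type
  finite : Finite V
  graph : DirColHypergraph C V

attribute [instance] FinDirColHypergraph.finite

namespace DirColHypergraph

variable {C : Type*}

/-- A hypergraph on a finite vertex type, bundled with its vertex type. -/
def toFin {V : Type} [Finite V] (G : DirColHypergraph C V) : FinDirColHypergraph C :=
  ⟨V, inferInstance, G⟩

/-- The hypergraph structure induced along an injection `f : W ↪ V`. -/
def comap {V W : Type} (f : W ↪ V) (G : DirColHypergraph C V) : DirColHypergraph C W where
  edges := {e | (e.1.map f, e.2) ∈ G.edges}
  finite_edges := by
    refine G.finite_edges.preimage (f := fun e : List W × C => (e.1.map f, e.2)) ?_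
    rintro ⟨l, c⟩ - ⟨l', c'⟩ - h
    simp only [Prod.mk.injEq] at h
    exact Prod.ext (List.map_injective_iff.2 f.injective h.1) h.2
  nodup := fun e he => List.Nodup.of_map f (G.nodup _ he)
  two_le_length := fun e he => by simpa using G.two_le_length _ he

/-- The induced subhypergraph `G[U]`: its edges are the edges of `G` all of whose vertices lie in `U`. -/
def induce {V : Type} (G : DirColHypergraph C V) (U : Set V) : DirColHypergraph C U :=
  G.comap (Function.Embedding.subtype (· ∈ U))

/-- `G ≤ H` : `G` is isomorphic to an induced subhypergraph `H[U]` of `H`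
(`U` being the range of the injection). -/
def IsInducedSub {V W : Type} (G : DirColHypergraph C V) (H : DirColHypergraph C W) : Prop :=
  ∃ f : V ↪ W, G = H.comap f

/-- Isomorphism of hypergraphs; it preserves the direction and the colour of each edge. -/
def IsIso {V W : Type} (G : DirColHypergraph C V) (H : DirColHypergraph C W) : Prop :=
  ∃ f : V ≃ W, G = H.comap f.toEmbedding

/-- The hypergraph `K₁` with one vertex (and no edges). -/
def K₁ : DirColHypergraph C Unit where
  edges := ∅
  finite_edges := Set.finite_empty
  nodup := by simp
  two_le_length := by simp

/-- The image of a hypergraph under an injection of the vertices. -/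
def map {V W : Type} (f : V ↪ W) (G : DirColHypergraph C V) : DirColHypergraph C W where
  edges := (fun e : List V × C => (e.1.map f, e.2)) '' G.edges
  finite_edges := G.finite_edges.image _
  nodup := by
    rintro _ ⟨e, he, rfl⟩
    exact (G.nodup e he).map f.injective
  two_le_length := by
    rintro _ ⟨e, he, rfl⟩
    simpa using G.two_le_length e he

/-- The disjoint union of a finite family of hypergraphs. -/
def disjUnion {ι : Type} [Finite ι] {V : ι → Type} (G : ∀ i, DirColHypergraph C (V i)) :
    DirColHypergraph C (Σ i, V i) where
  edges := ⋃ i, ((G i).map (Function.Embedding.sigmaMk i)).edges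
  finite_edges := Set.finite_iUnion fun i => ((G i).map _).finite_edges
  nodup := by
    intro e he
    obtain ⟨i, hi⟩ := Set.mem_iUnion.1 he
    exact ((G i).map _).nodup e hi
  two_le_length := by
    intro e he
    obtain ⟨i, hi⟩ := Set.mem_iUnion.1 he
    exact ((G i).map _).two_le_length e hi

/-- `kG`, the disjoint union of `k` copies of `G`. -/
def copies {V : Type} (k : ℕ) (G : DirColHypergraph C V) : DirColHypergraph C (Σ _ : Fin k, V) :=
  disjUnion fun _ => G

/-- The disjoint union of two hypergraphs. -/
def disjUnion₂ {V W : Type} (G : DirColHypergraph C V) (H : DirColHypergraph C W) : DirColHypergraph C (V ⊕ W) where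
  edges := (G.map Function.Embedding.inl).edges ∪ (H.map Function.Embedding.inr).edges
  finite_edges := (G.map _).finite_edges.union (H.map _).finite_edges
  nodup := by
    rintro e (he | he)
    exacts [(G.map _).nodup e he, (H.map _).nodup e he]
  two_le_length := by
    rintro e (he | he)
    exacts [(G.map _).two_le_length e he, (H.map _).two_le_length e he]

/-- The `*`-join of a family of hypergraphs: all hypergraphs `H` on the disjoint union of the vertex
sets `V(Gᵢ)` such that `H[V(Gᵢ)] = Gᵢ` for all `i`. -/
def starJoin {ι : Type} {V : ι → Type} (G : ∀ i, DirColHypergraph C (V i)) :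
    Set (DirColHypergraph C (Σ i, V i)) :=
  {H | ∀ i, H.comap (Function.Embedding.sigmaMk i) = G i}

/-- The `*`-join `G * H` of two hypergraphs. -/
def starJoin₂ {V W : Type} (G : DirColHypergraph C V) (H : DirColHypergraph C W) :
    Set (DirColHypergraph C (V ⊕ W)) :=
  {K | K.comap Function.Embedding.inl = G ∧ K.comap Function.Embedding.inr = H}

/-- The `s`-fold `*`-join `G * G * ⋯ * G`; the vertex `v` of the `j`-th copy of `G` is `⟨j, v⟩`. -/
def starPower {V : Type} (s : ℕ) (G : DirColHypergraph C V) : Set (DirColHypergraph C (Σ _ : Fin s, V)) :=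
  starJoin fun _ => G

/-- A hypergraph property: a non-empty isomorphism-closed class of finite hypergraphs. -/
def IsProperty (P : Set (FinDirColHypergraph C)) : Prop :=
  P.Nonempty ∧ ∀ G H : FinDirColHypergraph C, G.graph.IsIso H.graph → H ∈ P → G ∈ P

/-- `P` is closed under taking induced subhypergraphs. -/
def InducedHereditary (P : Set (FinDirColHypergraph C)) : Prop :=
  ∀ H ∈ P, ∀ K : FinDirColHypergraph C, K.graph.IsInducedSub H.graph → K ∈ P

/-- `P` is closed under taking the disjoint union of two hypergraphs. -/
def IsAdditive (P : Set (FinDirColHypergraph C)) : Prop :=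
  ∀ G ∈ P, ∀ H ∈ P, (disjUnion₂ G.graph H.graph).toFin ∈ P

/-- The smallest induced-hereditary property containing `𝒢`. -/
def generated (𝒢 : Set (FinDirColHypergraph C)) : Set (FinDirColHypergraph C) :=
  ⋂₀ {Q | IsProperty Q ∧ InducedHereditary Q ∧ 𝒢 ⊆ Q}

/-- `d` is a (unordered) `P`-decomposition of `G`: a partition of the vertex set into non-empty parts
`V₁, …, Vₙ` such that `kG[V₁] * ⋯ * kG[Vₙ] ⊆ P` for every positive integer `k`. -/
def IsDecomposition (P : Set (FinDirColHypergraph C)) {V : Type} [Finite V] (G : DirColHypergraph C V)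
    (d : Set (Set V)) : Prop :=
  Setoid.IsPartition d ∧
    ∀ k : ℕ, 0 < k → ∀ H ∈ starJoin (fun U : d => copies k (G.induce (U : Set V))), H.toFin ∈ P

/-- `d` is a `P`-decomposition of `G` with `n` parts. -/
def IsDecompositionWith (P : Set (FinDirColHypergraph C)) {V : Type} [Finite V] (G : DirColHypergraph C V)
    (n : ℕ) (d : Set (Set V)) : Prop :=
  IsDecomposition P G d ∧ d.ncard = n

open Classical in
/-- The `P`-decomposability number of `G`: the maximum number of parts in a `P`-decomposition of `G`,
and `0` if `G ∉ P`. (The number of parts is bounded, as `V` is finite.) -/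
noncomputable def dec (P : Set (FinDirColHypergraph C)) {V : Type} [Finite V] (G : DirColHypergraph C V) : ℕ :=
  if G.toFin ∈ P then sSup {n | ∃ d, IsDecompositionWith P G n d} else 0

/-- `G` is `P`-strict: `G ∈ P` but `G * K₁ ⊄ P`. -/
def IsStrict (P : Set (FinDirColHypergraph C)) {V : Type} [Finite V] (G : DirColHypergraph C V) : Prop :=
  G.toFin ∈ P ∧ ¬ ∀ H ∈ starJoin₂ G K₁, H.toFin ∈ P

/-- The decomposability number of `P`: the least decomposability number of a `P`-strict hypergraph. -/
noncomputable def decNumber (P : Set (FinDirColHypergraph C)) : ℕ :=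
  sInf {n | ∃ G : FinDirColHypergraph C, IsStrict P G.graph ∧ dec P G.graph = n}

/-- `G` is uniquely `P`-decomposable: it has exactly one `P`-decomposition with `dec P G` parts. -/
def IsUniquelyDecomposable (P : Set (FinDirColHypergraph C)) {V : Type} [Finite V]
    (G : DirColHypergraph C V) : Prop :=
  ∃! d, IsDecompositionWith P G (dec P G) d

/-- The `P`-strict, uniquely `P`-decomposable hypergraphs of minimum decomposability. -/
def strictUnique (P : Set (FinDirColHypergraph C)) : Set (FinDirColHypergraph C) :=
  {G | IsStrict P G.graph ∧ IsUniquelyDecomposable P G.graph ∧ dec P G.graph = decNumber P}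

/-- The restriction `d|Gʲ` of a partition `d` of the vertex set of a hypergraph in the `s`-fold
`*`-join of `G` to the `j`-th copy of `G`: the non-empty traces of the parts of `d` on that copy. -/
def restrictCopy {V : Type} {s : ℕ} (d : Set (Set (Σ _ : Fin s, V))) (j : Fin s) : Set (Set V) :=
  {U | U.Nonempty ∧ ∃ W ∈ d, U = {v | (⟨j, v⟩ : Σ _ : Fin s, V) ∈ W}}

end DirColHypergraph

/-! A decomposition is handled as a vertex colouring `φ`: a hypergraph made of copies of `G` lies in
`P` as soon as each `φ`-monochromatic tuple is an edge exactly when it lies in one copy and is an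
edge of `G` there. All other tuples are free, and two observations exploit this freedom.

First, if a strict `G` sits inside a coloured hypergraph, every colour occurs on it
(`IsStrict.exists_color_eq`): a vertex of a missing colour could play `K₁`, and every member of `G *
K₁` would be in `P`. Second, if two colourings with `dec P G` colours differ as partitions, their
common refinement has too many parts to be a colouring (`IsColoring.ker_eq_of_prod`), which yields a
hypergraph outside `P`.

For uniqueness, fix a decomposition `φ` of `G` with `dec P G` parts. The hypergraphs witnessing the
second observation are planted between copies of `G`, one competitor at a time, using only tuples
that are not `φ`-monochromatic, so `φ` survives. In the resulting `H`, no colouring can look like a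
competitor on every copy (`exists_respects_avoiding`), so some copy carries `φ`. Three levels of
copies of `H` are then linked cyclically by a forbidden `F ∈ G * K₁`: a copy carrying `φ` forces the
colour of every vertex of the next level (`color_succ_eq`), and going once around the cycle fixes
everything.

For generation, a given member of `P` is joined disjointly to a strict hypergraph of least `dec`.
The union is strict with the same `dec`, since `dec` cannot grow above a strict subhypergraph, and
the uniqueness construction applies to it. -/

namespace DirColHypergraph

/-! ### Tuples on which a map is constant -/

variable {C : Type*}

/-- The function `f` is constant on the entries of the list `l`. -/
def ConstOn {α β : Type*} (f : α → β) (l : List α) : Prop :=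
  ∀ x ∈ l, ∀ y ∈ l, f x = f y

theorem constOn_map {α β γ : Type*} {f : β → γ} {g : α → β} {l : List α} :
    ConstOn f (l.map g) ↔ ConstOn (fun x => f (g x)) l := by
  simp [ConstOn]

theorem constOn_prodMk {α β γ : Type*} {f : α → β} {g : α → γ} {l : List α} :
    ConstOn (fun x => (f x, g x)) l ↔ ConstOn f l ∧ ConstOn g l := by
  simp only [ConstOn, Prod.mk.injEq]
  exact ⟨fun h => ⟨fun x hx y hy => (h x hx y hy).1, fun x hx y hy => (h x hx y hy).2⟩,
    fun h x hx y hy => ⟨h.1 x hx y hy, h.2 x hx y hy⟩⟩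

theorem ConstOn.comp {α β γ : Type*} {f : α → β} {l : List α} (h : ConstOn f l) (g : β → γ) :
    ConstOn (fun x => g (f x)) l := fun x hx y hy => congrArg g (h x hx y hy)

theorem exists_map_eq {α β : Type*} {f : α → β} {l : List β} (h : ∀ x ∈ l, x ∈ Set.range f) :
    ∃ l' : List α, l'.map f = l := by
  have : l ∈ Set.range (List.map f) := by rw [Set.range_list_map]; exact h
  exact this

theorem exists_map_inl_eq {α : Type*} {l : List (α ⊕ Unit)} (h : Sum.inr () ∉ l) :
    ∃ l' : List α, l'.map Sum.inl = l := by
  refine exists_map_eq ?_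
  rintro (v | ⟨⟩) hx
  · exact ⟨v, rfl⟩
  · exact absurd hx h

/-! ### Edge membership and operations on hypergraphs -/

section Basic

variable {V W : Type}

theorem ext_edges {G H : DirColHypergraph C V}
    (h : ∀ l c, (l, c) ∈ G.edges ↔ (l, c) ∈ H.edges) : G = H :=
  DirColHypergraph.ext (Set.ext fun e => h e.1 e.2)

theorem mem_comap {f : W ↪ V} {G : DirColHypergraph C V} {l : List W} {c : C} :
    (l, c) ∈ (G.comap f).edges ↔ (l.map f, c) ∈ G.edges := Iff.rfl

theorem mem_map {f : V ↪ W} {G : DirColHypergraph C V} {l : List W} {c : C} :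
    (l, c) ∈ (G.map f).edges ↔ ∃ l', (l', c) ∈ G.edges ∧ l'.map f = l := by
  simp only [map, Set.mem_image, Prod.mk.injEq, Prod.exists]
  exact ⟨fun ⟨a, b, h, h1, h2⟩ => ⟨a, h2 ▸ h, h1⟩, fun ⟨a, h, h1⟩ => ⟨a, c, h, h1, rfl⟩⟩

theorem map_mem_map {f : V ↪ W} {G : DirColHypergraph C V} {l : List V} {c : C} :
    (l.map f, c) ∈ (G.map f).edges ↔ (l, c) ∈ G.edges := by
  rw [mem_map]
  constructor
  · rintro ⟨l', h, h'⟩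
    rwa [← List.map_injective_iff.2 f.injective h']
  · exact fun h => ⟨l, h, rfl⟩

theorem not_mem_of_length_lt {G : DirColHypergraph C V} {l : List V} {c : C} (h : l.length < 2) :
    (l, c) ∉ G.edges := fun he => absurd (G.two_le_length _ he) (by simpa using h)

theorem exists_ne_of_mem {G : DirColHypergraph C V} {l : List V} {c : C} (h : (l, c) ∈ G.edges)
    (x : V) : ∃ y ∈ l, y ≠ x := by
  have h1 := G.two_le_length _ h
  have h2 := G.nodup _ h
  match l, h1, h2 with
  | a :: b :: l, _, h2 =>
    by_cases ha : a = x
    · refine ⟨b, by simp, ?_⟩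
      rintro rfl
      subst ha
      simp at h2
    · exact ⟨a, by simp, ha⟩

/-- The hypergraph on `W` whose edges are the tuples that `f` maps to edges of `G`. -/
def pull [Finite W] (f : W → V) (G : DirColHypergraph C V) : DirColHypergraph C W where
  edges := {e | (e.1.map f, e.2) ∈ G.edges}
  finite_edges := by
    refine Set.Finite.preimage' (f := fun e : List W × C => (e.1.map f, e.2)) G.finite_edges ?_
    rintro ⟨l, c⟩ -
    refine ((List.finite_length_eq W l.length).prod (Set.finite_singleton c)).subset ?_
    rintro ⟨l', c'⟩ h
    simp only [Set.mem_preimage, Set.mem_singleton_iff, Prod.mk.injEq] at h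
    simp [← h.1, h.2]
  nodup := fun e he => List.Nodup.of_map f (G.nodup _ he)
  two_le_length := fun e he => by simpa using G.two_le_length _ he

theorem mem_pull [Finite W] {f : W → V} {G : DirColHypergraph C V} {l : List W} {c : C} :
    (l, c) ∈ (G.pull f).edges ↔ (l.map f, c) ∈ G.edges := Iff.rfl

/-- The edges of `G` whose vertex tuple satisfies `p`. -/
def sep (G : DirColHypergraph C V) (p : List V → Prop) : DirColHypergraph C V where
  edges := {e | e ∈ G.edges ∧ p e.1}
  finite_edges := G.finite_edges.subset fun _ h => h.1
  nodup := fun e he => G.nodup e he.1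
  two_le_length := fun e he => G.two_le_length e he.1

theorem mem_sep {G : DirColHypergraph C V} {p : List V → Prop} {l : List V} {c : C} :
    (l, c) ∈ (G.sep p).edges ↔ (l, c) ∈ G.edges ∧ p l := Iff.rfl

/-- The union of two hypergraphs on the same vertices. -/
def union (G H : DirColHypergraph C V) : DirColHypergraph C V where
  edges := G.edges ∪ H.edges
  finite_edges := G.finite_edges.union H.finite_edges
  nodup := fun e he => he.elim (G.nodup e) (H.nodup e)
  two_le_length := fun e he => he.elim (G.two_le_length e) (H.two_le_length e)

theorem mem_union {G H : DirColHypergraph C V} {l : List V} {c : C} :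
    (l, c) ∈ (G.union H).edges ↔ (l, c) ∈ G.edges ∨ (l, c) ∈ H.edges := Iff.rfl

/-- The union of a finite family of hypergraphs on the same vertices. -/
def iUnion {ι : Type*} [Finite ι] (G : ι → DirColHypergraph C V) : DirColHypergraph C V where
  edges := ⋃ i, (G i).edges
  finite_edges := Set.finite_iUnion fun i => (G i).finite_edges
  nodup := fun e he => by
    obtain ⟨i, hi⟩ := Set.mem_iUnion.1 he
    exact (G i).nodup e hi
  two_le_length := fun e he => by
    obtain ⟨i, hi⟩ := Set.mem_iUnion.1 he
    exact (G i).two_le_length e hi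

theorem mem_iUnion {ι : Type*} [Finite ι] {G : ι → DirColHypergraph C V} {l : List V} {c : C} :
    (l, c) ∈ (iUnion G).edges ↔ ∃ i, (l, c) ∈ (G i).edges := Set.mem_iUnion

theorem mem_copies {k : ℕ} {G : DirColHypergraph C V} {l : List (Σ _ : Fin k, V)} {c : C} :
    (l, c) ∈ (copies k G).edges ↔
      ConstOn (fun x => x.1) l ∧ (l.map (fun x => x.2), c) ∈ G.edges := by
  have key : (l, c) ∈ (copies k G).edges ↔
      ∃ i, (l, c) ∈ (G.map (Function.Embedding.sigmaMk (β := fun _ : Fin k => V) i)).edges :=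
    Set.mem_iUnion
  rw [key]
  simp only [mem_map]
  constructor
  · rintro ⟨i, l', h, rfl⟩
    refine ⟨by simp [ConstOn], ?_⟩
    rw [List.map_map]
    have : ((fun x : (Σ _ : Fin k, V) => x.2) ∘ (Function.Embedding.sigmaMk i)) = id := rfl
    rwa [this, List.map_id]
  · rintro ⟨h, h'⟩
    match l, h, h' with
    | [], _, h' => exact absurd h' (not_mem_of_length_lt (by simp))
    | a :: l, h, h' =>
      refine ⟨a.1, _, h', ?_⟩
      rw [List.map_map]
      refine (List.map_congr_left (g := id) fun x hx => ?_).trans (List.map_id _)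
      have := h x hx a (by simp)
      exact Sigma.ext this.symm HEq.rfl

end Basic

section Property

variable {P : Set (FinDirColHypergraph C)} {V W : Type}

theorem InducedHereditary.comap_mem (hP : InducedHereditary P) [Finite V] [Finite W]
    {H : DirColHypergraph C W} (h : H.toFin ∈ P) (f : V ↪ W) : (H.comap f).toFin ∈ P :=
  hP _ h _ ⟨f, rfl⟩

end Property

/-! ### Colourings as a form of decompositions -/

section Coloring

variable {P : Set (FinDirColHypergraph C)} {V W ι : Type}

/-- A vertex colouring of `G` is a `P`-colouring if its colour classes `V₁, …, Vₙ` satisfy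
`kG[V₁] * ⋯ * kG[Vₙ] ⊆ P` for all `k`. -/
def IsColoring (P : Set (FinDirColHypergraph C)) [Finite V] (G : DirColHypergraph C V)
    (φ : V → ι) : Prop :=
  ∀ (J : Type) [Finite J] (K : DirColHypergraph C (V × J)),
    (∀ l c, ConstOn (fun x => φ x.1) l →
      ((l, c) ∈ K.edges ↔ ConstOn Prod.snd l ∧ (l.map Prod.fst, c) ∈ G.edges)) → K.toFin ∈ P

/-- Every membership in `P` derived from a colouring goes through this: a hypergraph on part of `V ×
J` is completed by the monochromatic edges that a colouring prescribes, and heredity cuts it back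
down. -/
theorem IsColoring.mem (hP : InducedHereditary P) [Finite V] [Finite W]
    {G : DirColHypergraph C V} {φ : V → ι} (h : IsColoring P G φ) {J : Type} [Finite J]
    {K : DirColHypergraph C W} (p : W → V) (q : W → J)
    (hinj : Function.Injective fun w => (p w, q w))
    (hK : ∀ l c, ConstOn (fun x => φ (p x)) l →
      ((l, c) ∈ K.edges ↔ ConstOn q l ∧ (l.map p, c) ∈ G.edges)) : K.toFin ∈ P := by
  let f : W ↪ V × J := ⟨_, hinj⟩
  let K' : DirColHypergraph C (V × J) := (K.map f).union
    ((G.pull Prod.fst).sep fun l => ConstOn (fun x : V × J => φ x.1) l ∧ ConstOn Prod.snd l)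
  have hK' : K'.toFin ∈ P := by
    refine h J K' fun l c hl => ?_
    rw [mem_union, mem_sep, mem_pull]
    constructor
    · rintro (h1 | h1)
      · obtain ⟨l', h2, rfl⟩ := mem_map.1 h1
        rw [constOn_map] at hl ⊢
        have := (hK l' c hl).1 h2
        exact ⟨this.1, by rw [List.map_map]; exact this.2⟩
      · exact ⟨h1.2.2, h1.1⟩
    · exact fun h1 => Or.inr ⟨h1.2, hl, h1.1⟩
  have : K = K'.comap f := by
    refine ext_edges fun l c => ?_
    rw [mem_comap, mem_union, map_mem_map, mem_sep, mem_pull, constOn_map, constOn_map]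
    refine ⟨Or.inl, ?_⟩
    rintro (h1 | ⟨h1, h2, h3⟩)
    · exact h1
    · exact (hK l c h2).2 ⟨h3, by rw [List.map_map] at h1; exact h1⟩
  rw [this]
  exact hP.comap_mem hK' f

theorem IsColoring.mem_of_embedding (hP : InducedHereditary P) [Finite V] [Finite W]
    {G : DirColHypergraph C V} {φ : V → ι} (h : IsColoring P G φ)
    {K : DirColHypergraph C W} (p : W → V) (hp : Function.Injective p)
    (hK : ∀ l c, ConstOn (fun x => φ (p x)) l →
      ((l, c) ∈ K.edges ↔ (l.map p, c) ∈ G.edges)) : K.toFin ∈ P :=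
  h.mem hP p (fun _ => ()) (fun x y hxy => hp (Prod.ext_iff.1 hxy).1) fun l c hl => by
    rw [hK l c hl]
    simp [ConstOn]

theorem IsColoring.self_mem (hP : InducedHereditary P) [Finite V]
    {G : DirColHypergraph C V} {φ : V → ι} (h : IsColoring P G φ) : G.toFin ∈ P :=
  h.mem_of_embedding hP id Function.injective_id fun l c _ => by rw [List.map_id]

theorem IsColoring.congr [Finite V] {G : DirColHypergraph C V} {φ : V → ι} (h : IsColoring P G φ)
    {κ : Type} {ψ : V → κ} (hψ : ∀ x y, φ x = φ y ↔ ψ x = ψ y) : IsColoring P G ψ := by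
  intro J _ K hK
  refine h J K fun l c hl => hK l c fun x hx y hy => (hψ _ _).1 (hl x hx y hy)

theorem IsColoring.comap (hP : InducedHereditary P) [Finite V] [Finite W]
    {G : DirColHypergraph C V} {φ : V → ι} (h : IsColoring P G φ) (f : W ↪ V) :
    IsColoring P (G.comap f) (fun x => φ (f x)) := by
  intro J _ K hK
  refine h.mem hP (J := J) (fun x => f x.1) Prod.snd (fun x y hxy => ?_) fun l c hl => ?_
  · simp only [Prod.mk.injEq, EmbeddingLike.apply_eq_iff_eq] at hxy
    exact Prod.ext hxy.1 hxy.2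
  · rw [hK l c hl, mem_comap, List.map_map]
    rfl

/-- In a colouring of a hypergraph, each strict induced subhypergraph meets every colour. -/
theorem IsStrict.exists_color_eq (hP : InducedHereditary P) [Finite V] [Finite W]
    {H : DirColHypergraph C W} {φ : W → ι} (f : V ↪ W) (hG : IsStrict P (H.comap f))
    (h : IsColoring P H φ) (w : W) : ∃ v, φ (f v) = φ w := by
  by_contra! hw
  obtain ⟨-, hF⟩ := hG
  push Not at hF
  obtain ⟨F, ⟨hF1, -⟩, hF2⟩ := hF
  apply hF2
  -- The vertex `w` plays `K₁`. Its colour is absent from the copy of `G`, so no monochromatic tuple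
  -- of length at least two contains it, and `F` is free there.
  refine h.mem_of_embedding hP (Sum.elim f fun _ => w) ?_ fun l c hl => ?_
  · refine Function.Injective.sumElim f.injective (fun _ _ _ => rfl) fun v _ hv => ?_
    exact hw v (congrArg φ hv)
  · by_cases hr : Sum.inr () ∈ l
    · have h1 : ∀ x ∈ l, x = Sum.inr () := by
        rintro (v | ⟨⟩) hx
        · exact absurd (hl _ hx _ hr) (hw v)
        · rfl
      constructor
      · intro he
        obtain ⟨y, hy, hy'⟩ := exists_ne_of_mem he (Sum.inr ())
        exact absurd (h1 y hy) hy'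
      · intro he
        obtain ⟨y, hy, hy'⟩ := exists_ne_of_mem he w
        obtain ⟨x, hx, rfl⟩ := List.mem_map.1 hy
        rw [h1 x hx] at hy'
        exact absurd rfl hy'
    · obtain ⟨l', rfl⟩ := exists_map_inl_eq hr
      have : (l', c) ∈ (F.comap Function.Embedding.inl).edges ↔ (l', c) ∈ (H.comap f).edges := by
        rw [hF1]
      rw [List.map_map]
      exact this

end Coloring

/-! ### Partitions as classes of surjective colourings -/

section Partition

variable {V ι : Type}

/-- The set of colour classes of a colouring. -/
def classes (φ : V → ι) : Set (Set V) := Set.range fun i => φ ⁻¹' {i}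

theorem classes_eq_iff {φ : V → ι} {U U' : classes φ} {v v' : V} (hv : v ∈ (U : Set V))
    (hv' : v' ∈ (U' : Set V)) : U = U' ↔ φ v = φ v' := by
  obtain ⟨_, i, rfl⟩ := U
  obtain ⟨_, i', rfl⟩ := U'
  obtain rfl : φ v = i := hv
  obtain rfl : φ v' = i' := hv'
  constructor
  · intro h
    have : v ∈ φ ⁻¹' {φ v} := rfl
    rw [show φ ⁻¹' {φ v} = φ ⁻¹' {φ v'} from congrArg Subtype.val h] at this
    exact this
  · exact fun h => Subtype.ext (congrArg (fun i => φ ⁻¹' {i}) h)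

theorem isPartition_classes {φ : V → ι} (hφ : Function.Surjective φ) :
    Setoid.IsPartition (classes φ) := by
  refine ⟨?_, fun v => ⟨φ ⁻¹' {φ v}, ⟨⟨_, rfl⟩, rfl⟩, ?_⟩⟩
  · rintro ⟨i, hi⟩
    obtain ⟨v, rfl⟩ := hφ i
    exact Set.notMem_empty v (hi ▸ rfl)
  · rintro _ ⟨⟨i, rfl⟩, hv⟩
    rw [show φ v = i from hv]

theorem ncard_classes {n : ℕ} {φ : V → Fin n} (hφ : Function.Surjective φ) :
    (classes φ).ncard = n := by
  have hinj : Function.Injective fun i => φ ⁻¹' {i} := by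
    intro i j hij
    obtain ⟨v, rfl⟩ := hφ i
    have : v ∈ φ ⁻¹' {φ v} := rfl
    rw [show φ ⁻¹' {φ v} = φ ⁻¹' {j} from hij] at this
    exact this
  rw [classes, ← Set.image_univ, Set.ncard_image_of_injective _ hinj, Set.ncard_univ,
    Nat.card_eq_fintype_card, Fintype.card_fin]

theorem exists_classes_eq [Finite V] {d : Set (Set V)} (hd : Setoid.IsPartition d) {n : ℕ}
    (hn : d.ncard = n) : ∃ φ : V → Fin n, Function.Surjective φ ∧ classes φ = d := by
  have e : d ≃ Fin n := Finite.equivFinOfCardEq (by rw [Nat.card_coe_set_eq, hn])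
  choose c hc hc' using hd.2
  have hfib : ∀ U : d, (fun v => e ⟨c v, (hc v).1⟩) ⁻¹' {e U} = U := by
    intro U
    ext v
    simp only [Set.mem_preimage, Set.mem_singleton_iff, EmbeddingLike.apply_eq_iff_eq]
    constructor
    · rintro rfl
      exact (hc v).2
    · exact fun hv => Subtype.ext (hc' v U ⟨U.2, hv⟩).symm
  refine ⟨fun v => e ⟨c v, (hc v).1⟩, fun i => ?_, ?_⟩
  · obtain ⟨U, rfl⟩ := e.surjective i
    obtain ⟨v, hv⟩ := Setoid.nonempty_of_mem_partition hd U.2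
    exact ⟨v, by rw [← hfib U] at hv; exact hv⟩
  · ext U
    constructor
    · rintro ⟨i, rfl⟩
      obtain ⟨U, rfl⟩ := e.surjective i
      simp only [hfib]
      exact U.2
    · exact fun hU => ⟨e ⟨U, hU⟩, hfib _⟩

theorem classes_eq_of_ker {κ : Type} {φ : V → ι} {ψ : V → κ} (hφ : Function.Surjective φ)
    (hψ : Function.Surjective ψ) (h : ∀ x y, φ x = φ y ↔ ψ x = ψ y) : classes φ = classes ψ := by
  ext U
  constructor
  · rintro ⟨i, rfl⟩
    obtain ⟨v, rfl⟩ := hφ i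
    exact ⟨ψ v, Set.ext fun w => (h w v).symm⟩
  · rintro ⟨i, rfl⟩
    obtain ⟨v, rfl⟩ := hψ i
    exact ⟨φ v, Set.ext fun w => h w v⟩

end Partition

/-! ### Decompositions, colourings and the number `dec` -/

section Decomposition

variable {P : Set (FinDirColHypergraph C)} {V ι : Type}

theorem IsDecomposition.isColoring (hP : InducedHereditary P) [Finite V]
    {G : DirColHypergraph C V} {φ : V → ι} (h : IsDecomposition P G (classes φ)) :
    IsColoring P G φ := by
  intro J _ K hK
  obtain ⟨k, hk, ⟨e⟩⟩ : ∃ k : ℕ, 0 < k ∧ Nonempty (J ↪ Fin k) := by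
    -- The extra copy keeps `k` positive when `J` is empty.
    refine ⟨Nat.card J + 1, Nat.succ_pos _, ⟨(Finite.equivFin J).toEmbedding.trans ?_⟩⟩
    exact Fin.castSuccEmb
  let T := Σ U : classes φ, Σ _ : Fin k, (U : Set V)
  let cls : V → classes φ := fun v => ⟨φ ⁻¹' {φ v}, ⟨_, rfl⟩⟩
  let g : V × J ↪ T := ⟨fun x => ⟨cls x.1, e x.2, ⟨x.1, rfl⟩⟩, by
    intro x y hxy
    have h1 : x.1 = y.1 := congrArg (fun t : T => (t.2.2 : V)) hxy
    have h2 : e x.2 = e y.2 := congrArg (fun t : T => t.2.1) hxy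
    exact Prod.ext h1 (e.injective h2)⟩
  have hcls : ∀ t t' : T, t.1 = t'.1 ↔ φ t.2.2 = φ t'.2.2 :=
    fun t t' => classes_eq_iff t.2.2.2 t'.2.2.2
  -- The edges of `K`, completed by the edges inside single parts that membership in the `*`-join
  -- prescribes.
  let H : DirColHypergraph C T := (K.map g).union ((G.pull fun t => (t.2.2 : V)).sep fun l =>
    ConstOn (fun t : T => t.2.1) l ∧ ConstOn (fun t : T => φ t.2.2) l)
  have hH : H.toFin ∈ P := by
    refine h.2 k hk H fun U => ext_edges fun l c => ?_
    rw [mem_copies, mem_comap, mem_union, mem_sep, mem_pull, constOn_map, constOn_map]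
    change _ ↔ _ ∧ ((l.map fun x => x.2).map Subtype.val, c) ∈ G.edges
    rw [List.map_map, List.map_map]
    constructor
    · rintro (h1 | h1)
      · obtain ⟨l', h2, h3⟩ := mem_map.1 h1
        have hc : ConstOn (fun x => φ x.1) l' := by
          have : ConstOn (fun t : T => φ t.2.2) (l'.map g) := by
            rw [h3, constOn_map]
            exact fun x _ y _ => (hcls ⟨U, x⟩ ⟨U, y⟩).1 rfl
          rwa [constOn_map] at this
        obtain ⟨h4, h5⟩ := (hK l' c hc).1 h2
        constructor
        · have : ConstOn (fun t : T => t.2.1) (l'.map g) := by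
            rw [constOn_map]
            exact h4.comp e
          rwa [h3, constOn_map] at this
        · have : (l'.map g).map (fun t : T => (t.2.2 : V)) = l'.map Prod.fst := by
            rw [List.map_map]
            rfl
          rw [h3, List.map_map] at this
          rw [← this] at h5
          exact h5
      · exact ⟨h1.2.1, h1.1⟩
    · exact fun h1 => Or.inr ⟨h1.2, h1.1, fun x _ y _ => (hcls ⟨U, x⟩ ⟨U, y⟩).1 rfl⟩
  have : K = H.comap g := by
    refine ext_edges fun l c => ?_
    rw [mem_comap, mem_union, map_mem_map, mem_sep, mem_pull, constOn_map, constOn_map,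
      List.map_map]
    refine ⟨Or.inl, ?_⟩
    rintro (h1 | ⟨h1, h2, h3⟩)
    · exact h1
    · exact (hK l c h3).2 ⟨fun x hx y hy => e.injective (h2 x hx y hy), h1⟩
  rw [this]
  exact hP.comap_mem hH g

theorem IsColoring.isDecomposition (hP : InducedHereditary P) [Finite V]
    {G : DirColHypergraph C V} {φ : V → ι} (hφ : Function.Surjective φ) (h : IsColoring P G φ) :
    IsDecomposition P G (classes φ) := by
  refine ⟨isPartition_classes hφ, fun k _ H hH => ?_⟩
  have hcls : ∀ t t' : Σ U : classes φ, Σ _ : Fin k, (U : Set V),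
      φ t.2.2 = φ t'.2.2 → t.1 = t'.1 :=
    fun t t' => (classes_eq_iff t.2.2.2 t'.2.2.2).2
  refine h.mem hP (fun t => (t.2.2 : V)) (fun t => t.2.1) ?_ fun l c hl => ?_
  · rintro ⟨U, j, v⟩ ⟨U', j', v'⟩ hx
    simp only [Prod.mk.injEq] at hx
    obtain rfl : U = U' := hcls ⟨U, j, v⟩ ⟨U', j', v'⟩ (congrArg φ hx.1)
    obtain rfl := hx.2
    obtain rfl := Subtype.ext hx.1
    rfl
  · match l, hl with
    | [], _ =>
      exact ⟨fun h => absurd h (not_mem_of_length_lt (by simp)),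
        fun h => absurd h.2 (not_mem_of_length_lt (by simp))⟩
    | a :: l, hl =>
      obtain ⟨l', hl'⟩ := exists_map_eq
        (f := Function.Embedding.sigmaMk (β := fun U : classes φ => Σ _ : Fin k, (U : Set V)) a.1)
        (l := a :: l) fun x hx => by
          obtain ⟨U, y⟩ := x
          obtain rfl : U = a.1 := hcls _ _ (hl _ hx a (by simp))
          exact ⟨y, rfl⟩
      rw [← hl', ← mem_comap, hH a.1, mem_copies, constOn_map, List.map_map]
      change _ ∧ ((l'.map fun x => x.2).map Subtype.val, c) ∈ G.edges ↔ _
      rw [List.map_map]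
      rfl

theorem isDecompositionWith_iff (hP : InducedHereditary P) [Finite V] {G : DirColHypergraph C V}
    {n : ℕ} {d : Set (Set V)} : IsDecompositionWith P G n d ↔
      ∃ φ : V → Fin n, Function.Surjective φ ∧ IsColoring P G φ ∧ classes φ = d := by
  constructor
  · rintro ⟨h, hn⟩
    obtain ⟨φ, hφ, rfl⟩ := exists_classes_eq h.1 hn
    exact ⟨φ, hφ, h.isColoring hP, rfl⟩
  · rintro ⟨φ, hφ, h, rfl⟩
    exact ⟨h.isDecomposition hP hφ, ncard_classes hφ⟩

theorem bddAbove_card_decomposition [Finite V] (G : DirColHypergraph C V) :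
    BddAbove {n | ∃ d, IsDecompositionWith P G n d} := by
  refine ⟨Nat.card V, ?_⟩
  rintro n ⟨d, hd, hn⟩
  obtain ⟨φ, hφ, -⟩ := exists_classes_eq hd.1 hn
  simpa using Nat.card_le_card_of_surjective φ hφ

theorem IsColoring.exists_isDecompositionWith (hP : InducedHereditary P) [Finite V]
    {G : DirColHypergraph C V} {φ : V → ι} (h : IsColoring P G φ) :
    ∃ d, IsDecompositionWith P G (Set.range φ).ncard d := by
  have : Finite (Set.range φ) := Set.finite_range φ
  let e : Set.range φ ≃ Fin (Set.range φ).ncard :=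
    Finite.equivFinOfCardEq (Nat.card_coe_set_eq _)
  refine ⟨_, (isDecompositionWith_iff hP).2 ⟨fun v => e (Set.rangeFactorization φ v),
    e.surjective.comp Set.rangeFactorization_surjective, h.congr fun x y => ?_, rfl⟩⟩
  rw [EmbeddingLike.apply_eq_iff_eq, Subtype.ext_iff]
  rfl

theorem IsColoring.ncard_range_le_dec (hP : InducedHereditary P) [Finite V]
    {G : DirColHypergraph C V} {φ : V → ι} (h : IsColoring P G φ) :
    (Set.range φ).ncard ≤ dec P G := by
  rw [dec, if_pos (h.self_mem hP)]
  exact le_csSup (bddAbove_card_decomposition G) (h.exists_isDecompositionWith hP)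

/-- A hypergraph of `P` has a decomposition with the maximum number of parts. -/
theorem exists_isDecompositionWith_dec (hP : InducedHereditary P) [Finite V]
    {G : DirColHypergraph C V} (hne : ∃ n d, IsDecompositionWith P G n d) :
    ∃ d, IsDecompositionWith P G (dec P G) d := by
  obtain ⟨n, d, hd⟩ := hne
  have hG : G.toFin ∈ P := by
    obtain ⟨φ, -, h, -⟩ := (isDecompositionWith_iff hP).1 hd
    exact h.self_mem hP
  rw [dec, if_pos hG]
  exact Nat.sSup_mem (s := {n | ∃ d, IsDecompositionWith P G n d}) ⟨n, d, hd⟩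
    (bddAbove_card_decomposition G)

/-- With no decomposition at all, `dec` is the supremum of the empty set or the default value, both
`0`. -/
theorem dec_le_of_forall (hP : InducedHereditary P) [Finite V] {G : DirColHypergraph C V} {n : ℕ}
    (h : ∀ (m : ℕ) (φ : V → Fin m), Function.Surjective φ → IsColoring P G φ → m ≤ n) :
    dec P G ≤ n := by
  by_cases hne : ∃ m d, IsDecompositionWith P G m d
  · obtain ⟨d, hd⟩ := exists_isDecompositionWith_dec hP hne
    obtain ⟨φ, hφ, hc, -⟩ := (isDecompositionWith_iff hP).1 hd
    exact h _ φ hφ hc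
  · have : {m | ∃ d, IsDecompositionWith P G m d} = ∅ := by
      ext m
      simpa using fun d hd => hne ⟨m, d, hd⟩
    rw [dec, this]
    split_ifs <;> simp

/-- Two colourings with the maximum number of colours whose common refinement is a colouring
have the same classes. -/
theorem IsColoring.ker_eq_of_prod (hP : InducedHereditary P) [Finite V]
    {G : DirColHypergraph C V} {φ ψ : V → Fin (dec P G)} (hφ : Function.Surjective φ)
    (hψ : Function.Surjective ψ) (h : IsColoring P G fun v => (φ v, ψ v)) (x y : V) :
    φ x = φ y ↔ ψ x = ψ y := by
  have hcard := h.ncard_range_le_dec hP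
  have hfin : (Set.range fun v => (φ v, ψ v)).Finite := Set.finite_range _
  -- The refinement has at most `dec P G` colours, yet each projection hits all `dec P G` values, so
  -- it is injective on the colours that occur.
  have key : ∀ π : Fin (dec P G) × Fin (dec P G) → Fin (dec P G),
      (Function.Surjective fun v => π (φ v, ψ v)) →
      Set.InjOn π (Set.range fun v => (φ v, ψ v)) := by
    intro π hπ
    refine Set.injOn_of_ncard_image_eq ?_ hfin
    refine le_antisymm (Set.ncard_image_le hfin) ?_
    rw [← Set.range_comp]
    rw [show π ∘ (fun v => (φ v, ψ v)) = fun v => π (φ v, ψ v) from rfl, hπ.range_eq]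
    simpa [Set.ncard_univ] using hcard
  constructor
  · exact fun hxy => congrArg Prod.snd (key Prod.fst hφ ⟨x, rfl⟩ ⟨y, rfl⟩ hxy)
  · exact fun hxy => congrArg Prod.fst (key Prod.snd hψ ⟨x, rfl⟩ ⟨y, rfl⟩ hxy)

end Decomposition

/-! ### Excluding competing colourings on some copy -/

section Respects

variable {P : Set (FinDirColHypergraph C)} {V J ι : Type}

/-- The hypergraph `H` on copies of the vertex set of `G` is in the `*`-join of the copies of `G`,
and in the `*`-join of the disjoint unions of the copies of each colour class of `G`. -/
def Respects (G : DirColHypergraph C V) (φ : V → ι) (H : DirColHypergraph C (V × J)) : Prop :=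
  ∀ l c, ConstOn (fun x => φ x.1) l ∨ ConstOn Prod.snd l →
    ((l, c) ∈ H.edges ↔ ConstOn Prod.snd l ∧ (l.map Prod.fst, c) ∈ G.edges)

/-- Copies of copies are copies: `J'` copies of the colour classes of `H` amount to `J × J'` copies
of those of `G`. -/
theorem Respects.isColoring (hP : InducedHereditary P) [Finite V] [Finite J]
    {G : DirColHypergraph C V} {φ : V → ι} {H : DirColHypergraph C (V × J)} (hH : Respects G φ H)
    (h : IsColoring P G φ) : IsColoring P H fun x => φ x.1 := by
  intro J' _ K hK
  refine h.mem hP (J := J × J') (fun x => x.1.1) (fun x => (x.1.2, x.2)) ?_ fun l c hl => ?_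
  · rintro ⟨⟨v, j⟩, j'⟩ ⟨⟨v', i⟩, i'⟩ hx
    simpa [and_assoc] using hx
  · rw [hK l c hl, hH _ _ (Or.inl (by rwa [constOn_map])), List.map_map, constOn_map,
      constOn_prodMk, and_left_comm, ← and_assoc]
    rfl

/-- The inclusion of the `j`-th copy. -/
def copyEmb (V : Type) {J : Type} (j : J) : V ↪ V × J :=
  ⟨fun v => (v, j), fun _ _ h => by simpa using h⟩

theorem Respects.comap_copyEmb {G : DirColHypergraph C V} {φ : V → ι}
    {H : DirColHypergraph C (V × J)} (hH : Respects G φ H) (j : J) :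
    H.comap (copyEmb V j) = G := by
  refine ext_edges fun l c => ?_
  have hc : ConstOn Prod.snd (l.map (copyEmb V j)) := by
    rw [constOn_map]
    exact fun _ _ _ _ => rfl
  rw [mem_comap, hH _ _ (Or.inr hc), List.map_map]
  have : Prod.fst ∘ copyEmb V j = id := rfl
  rw [this, List.map_id]
  exact ⟨fun h => h.2, fun h => ⟨hc, h⟩⟩

/-- Any finite set of colourings of `G` whose common refinement with `φ` is not a `P`-colouring can
be avoided on some copy of `G`, in each colouring of a suitable `*`-join of copies of `G`. -/
theorem exists_respects_avoiding (hP : InducedHereditary P) [Finite V] {G : DirColHypergraph C V}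
    [Finite ι] {φ : V → ι} {B : Set (V → ι)} (hB : B.Finite)
    (hbad : ∀ f ∈ B, ¬ IsColoring P G fun v => (φ v, f v)) :
    ∃ (J : Type) (_ : Finite J) (H : DirColHypergraph C (V × J)), Respects G φ H ∧
      ∀ ψ : V × J → ι, IsColoring P H ψ → ∃ j, (fun v => ψ (v, j)) ∉ B := by
  induction B, hB using Set.Finite.induction_on with
  | empty =>
    refine ⟨Unit, inferInstance, G.pull Prod.fst, fun l c _ => ?_, fun _ _ => ⟨(), fun h => h⟩⟩
    simp [mem_pull, ConstOn]
  | @insert f B _ _ ih =>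
    obtain ⟨J, _, H, hH, hHB⟩ := ih fun g hg => hbad g (Set.mem_insert_of_mem _ hg)
    have hf := hbad f (Set.mem_insert _ _)
    simp only [IsColoring] at hf
    push Not at hf
    obtain ⟨J', _, K, hK, hKP⟩ := hf
    -- A copy of `H` for each pair of a colour and a copy index of `K`. Link edges use only vertices
    -- of `φ`-colour `i` in copies labelled `(i, j')`, so a link edge inside one copy of `H` would
    -- be `φ`-monochromatic, which is excluded: the copies of `H` stay induced.
    let R := ι × J'
    let H' : DirColHypergraph C (V × (R × J)) :=
      ((H.pull fun x => (x.1, x.2.2)).sep (ConstOn fun x => x.2.1)).union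
      ((K.pull fun x => (x.1, x.2.1.2)).sep fun l => ¬ ConstOn (fun x => φ x.1) l ∧
        (∀ x ∈ l, φ x.1 = x.2.1.1) ∧ ∀ x ∈ l, ∀ y ∈ l, x.2.1 = y.2.1 → x.2.2 = y.2.2)
    have hsep : ∀ l c, ConstOn (fun x => φ x.1) l ∨ ConstOn (fun x => x.2.1) l →
        ((l, c) ∈ H'.edges ↔ ConstOn (fun x => x.2.1) l ∧
          (l.map (fun x => (x.1, x.2.2)), c) ∈ H.edges) := by
      intro l c hl
      rw [mem_union, mem_sep, mem_pull, mem_sep, mem_pull, and_comm]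
      refine or_iff_left fun ⟨_, h1, h2, _⟩ => h1 ?_
      refine hl.elim id fun hl x hx y hy => ?_
      refine (h2 x hx).trans (Eq.trans ?_ (h2 y hy).symm)
      exact congrArg Prod.fst (hl x hx y hy)
    have hH' : Respects G φ H' := by
      intro l c hl
      have hs : ConstOn Prod.snd l ↔
          ConstOn (fun x : V × (R × J) => x.2.1) l ∧ ConstOn (fun x => x.2.2) l := by
        rw [← constOn_prodMk]
      rw [hsep l c (hl.imp_right fun h => (hs.1 h).1), hH, constOn_map, List.map_map, hs, and_assoc]
      · rfl
      · rw [constOn_map, constOn_map]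
        exact hl.imp_right fun h => (hs.1 h).2
    refine ⟨R × J, inferInstance, H', hH', fun ψ hψ => ?_⟩
    by_contra! hall
    have hx : ∀ r : R, ∃ j, (fun v => ψ (v, (r, j))) = f := by
      intro r
      let g : V × J ↪ V × (R × J) := ⟨fun x => (x.1, (r, x.2)), fun x y h => by
        simpa [Prod.ext_iff] using h⟩
      have hg : H'.comap g = H := by
        refine ext_edges fun l c => ?_
        have hc : ConstOn (fun x => x.2.1) (l.map g) := by
          rw [constOn_map]
          exact fun _ _ _ _ => rfl
        rw [mem_comap, hsep _ _ (Or.inr hc), List.map_map]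
        have : (fun x : V × (R × J) => (x.1, x.2.2)) ∘ g = id := rfl
        rw [this, List.map_id]
        exact and_iff_right hc
      have hc := hψ.comap hP g
      rw [hg] at hc
      obtain ⟨j, hj⟩ := hHB _ hc
      exact ⟨j, ((Set.mem_insert_iff.1 (hall (r, j))).resolve_right hj)⟩
    choose t ht using hx
    apply hKP
    -- If every copy of `G` were coloured by a member of `insert f B`, each copy of `H` would
    -- contain one coloured exactly by `f`. Placing `K` on these makes `ψ` read as `f`; the
    -- `φ`-monochromatic tuples are right because copies are respected, the others because they were
    -- planted. Hence `K ∈ P`, a contradiction.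
    let p : V × J' → V × (R × J) := fun x => (x.1, ((φ x.1, x.2), t (φ x.1, x.2)))
    have hψp : ∀ x, ψ (p x) = f x.1 := fun x => congrFun (ht (φ x.1, x.2)) x.1
    refine hψ.mem_of_embedding hP p (fun x y h => ?_) fun l c hl => ?_
    · exact Prod.ext (congrArg (fun z : V × (R × J) => z.1) h)
        (congrArg (fun z : V × (R × J) => z.2.1.2) h)
    · simp only [hψp] at hl
      by_cases hφ : ConstOn (fun x => φ x.1) l
      · rw [hK l c (constOn_prodMk.2 ⟨hφ, hl⟩), hH' _ _ (Or.inl (by rwa [constOn_map])),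
          constOn_map, List.map_map]
        refine and_congr_left' ⟨fun h x hx y hy => ?_, fun h x hx y hy => ?_⟩
        · simp only [p, hφ x hx y hy, h x hx y hy]
        · exact congrArg (fun z : R × J => z.1.2) (h x hx y hy)
      · rw [mem_union, mem_sep, mem_pull, mem_sep, mem_pull, List.map_map, List.map_map,
          constOn_map, constOn_map]
        have : (fun x : V × (R × J) => (x.1, x.2.1.2)) ∘ p = id := rfl
        rw [this, List.map_id]
        constructor
        · refine fun h => Or.inr ⟨h, hφ, ?_, ?_⟩
          · simp only [List.forall_mem_map]
            exact fun _ _ => rfl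
          · simp only [List.forall_mem_map, p]
            intro x _ y _ hxy
            rw [hxy]
        · rintro (⟨_, h⟩ | h)
          · exact absurd (h.comp Prod.fst) hφ
          · exact h.1

end Respects

/-! ### Propagating a colouring around three linked levels -/

section Cyclic

variable {P : Set (FinDirColHypergraph C)} {V J ι : Type}

/-- The map sending level `t + 1` to the additional vertex, and other vertices to those of `V`. -/
def collapse (t : ZMod 3) (x : V × (ZMod 3 × J)) : V ⊕ Unit :=
  if x.2.1 = t + 1 then Sum.inr () else Sum.inl x.1

/-- The edges of type `F` between the vertices of level `t + 1` and the copies in level `t`. -/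
def linkEdges [Finite V] [Finite J] (φ : V → ι) (F : DirColHypergraph C (V ⊕ Unit)) (t : ZMod 3) :
    DirColHypergraph C (V × (ZMod 3 × J)) :=
  -- Edges of `F` have distinct vertices, so such a tuple has at most one vertex in level `t + 1`.
  -- Excluding `φ`-monochromatic tuples keeps `φ` a colouring.
  (F.pull (collapse t)).sep fun l => ¬ ConstOn (fun x => φ x.1) l ∧
    ∃ j, ∀ x ∈ l, x.2.1 = t + 1 ∨ x.2 = (t, j)

/-- Three levels of disjoint copies of `H`, cyclically linked by edges of type `F`. -/
def cyclicLink [Finite V] [Finite J] (φ : V → ι) (H : DirColHypergraph C (V × J))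
    (F : DirColHypergraph C (V ⊕ Unit)) : DirColHypergraph C (V × (ZMod 3 × J)) :=
  ((H.pull fun x => (x.1, x.2.2)).sep (ConstOn fun x => x.2.1)).union (iUnion (linkEdges φ F))

variable [Finite V] [Finite J] {G : DirColHypergraph C V} {φ : V → ι}
  {H : DirColHypergraph C (V × J)} {F : DirColHypergraph C (V ⊕ Unit)}

/-- A link edge within one level cannot use level `t + 1`, where all vertices collapse to one. It
therefore lies in a single copy of `G`, where `F` agrees with `G`, so linking does not alter the
levels. -/
theorem constSnd_of_mem_linkEdges (hF : F.comap Function.Embedding.inl = G) {t : ZMod 3}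
    {l : List (V × (ZMod 3 × J))} {c : C} (hl : ConstOn (fun x => x.2.1) l)
    (h : (l, c) ∈ (linkEdges φ F t).edges) :
    ConstOn Prod.snd l ∧ (l.map Prod.fst, c) ∈ G.edges := by
  obtain ⟨h1, h2, j, hj⟩ := h
  by_cases hex : ∃ x ∈ l, x.2.1 = t + 1
  · obtain ⟨x, hx, hxt⟩ := hex
    obtain ⟨y, hy, hne⟩ := exists_ne_of_mem (mem_pull.1 h1) (Sum.inr ())
    obtain ⟨z, hz, rfl⟩ := List.mem_map.1 hy
    exact absurd (if_pos ((hl z hz x hx).trans hxt)) hne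
  · push Not at hex
    have hs : ∀ x ∈ l, x.2 = (t, j) := fun x hx => (hj x hx).resolve_left (hex x hx)
    refine ⟨fun x hx y hy => (hs x hx).trans (hs y hy).symm, ?_⟩
    rw [← hF, mem_comap, List.map_map]
    have : l.map (collapse t) = l.map (Function.Embedding.inl ∘ Prod.fst) :=
      List.map_congr_left fun x hx => if_neg (hex x hx)
    rw [← this]
    exact h1

theorem mem_cyclicLink_of_constOn (hF : F.comap Function.Embedding.inl = G) (hH : Respects G φ H)
    {l : List (V × (ZMod 3 × J))} {c : C}
    (hl : ConstOn (fun x => φ x.1) l ∨ ConstOn (fun x => x.2.1) l) :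
    (l, c) ∈ (cyclicLink φ H F).edges ↔
      ConstOn (fun x => x.2.1) l ∧ (l.map (fun x => (x.1, x.2.2)), c) ∈ H.edges := by
  rw [cyclicLink, mem_union, mem_sep, mem_pull, and_comm]
  refine or_iff_left_of_imp fun h => ?_
  obtain ⟨t, h⟩ := mem_iUnion.1 h
  have hl' := hl.resolve_left h.2.1
  refine ⟨hl', ?_⟩
  obtain ⟨h1, h2⟩ := constSnd_of_mem_linkEdges hF hl' h
  have hc : ConstOn Prod.snd (l.map fun x => (x.1, x.2.2)) := by
    rw [constOn_map]
    exact h1.comp Prod.snd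
  rw [hH _ _ (Or.inr hc), List.map_map]
  exact ⟨hc, h2⟩

theorem respects_cyclicLink (hF : F.comap Function.Embedding.inl = G) (hH : Respects G φ H) :
    Respects G φ (cyclicLink φ H F) := by
  intro l c hl
  have hs : ConstOn Prod.snd l ↔
      ConstOn (fun x : V × (ZMod 3 × J) => x.2.1) l ∧ ConstOn (fun x => x.2.2) l := by
    rw [← constOn_prodMk]
  rw [mem_cyclicLink_of_constOn hF hH (hl.imp_right fun h => (hs.1 h).1), hH, constOn_map,
    List.map_map, hs, and_assoc]
  · rfl
  · rw [constOn_map, constOn_map]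
    exact hl.imp_right fun h => (hs.1 h).2

/-- The inclusion of level `t`. -/
def levelEmb (V J : Type) (t : ZMod 3) : V × J ↪ V × (ZMod 3 × J) :=
  ⟨fun x => (x.1, (t, x.2)), fun x y h => by simpa [Prod.ext_iff] using h⟩

theorem comap_cyclicLink_levelEmb (hF : F.comap Function.Embedding.inl = G) (hH : Respects G φ H)
    (t : ZMod 3) : (cyclicLink φ H F).comap (levelEmb V J t) = H := by
  refine ext_edges fun l c => ?_
  have hc : ConstOn (fun x => x.2.1) (l.map (levelEmb V J t)) := by
    rw [constOn_map]
    exact fun _ _ _ _ => rfl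
  rw [mem_comap, mem_cyclicLink_of_constOn hF hH (Or.inr hc), List.map_map]
  have : (fun x : V × (ZMod 3 × J) => (x.1, x.2.2)) ∘ levelEmb V J t = id := rfl
  rw [this, List.map_id]
  exact and_iff_right hc

theorem zmod_three_ne (t : ZMod 3) : t ≠ t + 1 := by
  revert t
  decide

/-- Why three levels: two adjacent levels determine the direction of the link between them, which
fails for a cycle of length two. -/
theorem zmod_three_eq (t u : ZMod 3) (h : t = u + 1 ∨ t = u) (h' : t + 1 = u + 1 ∨ t + 1 = u) :
    t = u := by
  revert t u
  decide

/-- A colouring that is equivalent to `φ` on a copy in level `t` extends uniformly to the next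
level. -/
theorem color_succ_eq (hP : InducedHereditary P) (hG : IsStrict P G)
    (hF : F.comap Function.Embedding.inl = G) (hFP : F.toFin ∉ P) (hH : Respects G φ H)
    {κ : Type} {ψ : V × (ZMod 3 × J) → κ} (hψ : IsColoring P (cyclicLink φ H F) ψ)
    {t : ZMod 3} {j : J} (hker : ∀ x y, φ x = φ y ↔ ψ (x, (t, j)) = ψ (y, (t, j))) (v : V) (i : J) :
    ψ (v, (t + 1, i)) = ψ (v, (t, j)) := by
  have hR := respects_cyclicLink hF hH
  obtain ⟨u, hu⟩ : ∃ u, ψ (u, (t, j)) = ψ (v, (t + 1, i)) := by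
    refine IsStrict.exists_color_eq hP (copyEmb V (t, j)) ?_ hψ (v, (t + 1, i))
    rwa [hR.comap_copyEmb]
  rw [← hu, ← hker]
  by_contra hne
  apply hFP
  -- If `φ u ≠ φ v`, a `ψ`-monochromatic tuple through the new vertex meets the copy only in
  -- `φ`-class of `u`. It is then not `φ`-monochromatic, so the links reproduce `F` on it and `F`
  -- would be in `P`.
  let p : V ⊕ Unit → V × (ZMod 3 × J) := Sum.elim (fun x => (x, (t, j))) fun _ => (v, (t + 1, i))
  have hp : Function.Injective p := by
    refine Function.Injective.sumElim (fun x y h => congrArg Prod.fst h) (fun _ _ _ => rfl) ?_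
    intro x _ h
    exact zmod_three_ne t (congrArg (fun z : V × (ZMod 3 × J) => z.2.1) h)
  have hcol : ∀ l : List (V ⊕ Unit), (l.map p).map (collapse t) = l := by
    intro l
    rw [List.map_map]
    refine (List.map_congr_left (g := id) ?_).trans (List.map_id _)
    rintro (x | ⟨⟩) _
    · exact if_neg (zmod_three_ne t)
    · exact if_pos rfl
  refine hψ.mem_of_embedding hP p hp fun l c hl => ?_
  by_cases hr : Sum.inr () ∈ l
  · constructor
    · intro h
      refine Or.inr (mem_iUnion.2 ⟨t, ?_, fun hφ => ?_, j, ?_⟩)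
      · change ((l.map p).map (collapse t), c) ∈ F.edges
        rwa [hcol]
      · obtain ⟨x | ⟨⟩, hx, hx'⟩ := exists_ne_of_mem h (Sum.inr ())
        · have h1 : φ x = φ v := (constOn_map.1 hφ) _ hx _ hr
          have h2 : ψ (x, (t, j)) = ψ (v, (t + 1, i)) := hl _ hx _ hr
          rw [← hu, ← hker] at h2
          exact hne (h2.symm.trans h1)
        · exact hx' rfl
      · simp only [List.forall_mem_map]
        rintro (x | ⟨⟩) _
        · exact Or.inr rfl
        · exact Or.inl rfl
    · intro h
      have hr' : (v, (t + 1, i)) ∈ l.map p := List.mem_map.2 ⟨_, hr, rfl⟩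
      obtain ⟨y, hy, hyne⟩ := exists_ne_of_mem h (v, (t + 1, i))
      obtain ⟨x | ⟨⟩, hx, rfl⟩ := List.mem_map.1 hy
      · rcases h with h | h
        · exact absurd (h.2 _ hy _ hr') (zmod_three_ne t)
        · obtain ⟨t', h1, -, j', h3⟩ := mem_iUnion.1 h
          obtain rfl : t = t' := zmod_three_eq t t' ((h3 _ hy).imp_right (congrArg Prod.fst))
            ((h3 _ hr').imp_right (congrArg Prod.fst))
          change ((l.map p).map (collapse t), c) ∈ F.edges at h1
          rwa [hcol] at h1
      · exact absurd rfl hyne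
  · obtain ⟨l', rfl⟩ := exists_map_inl_eq hr
    rw [List.map_map]
    have h1 : (l'.map Sum.inl, c) ∈ F.edges ↔ (l', c) ∈ G.edges := by
      rw [← hF]
      rfl
    rw [h1, ← hR.comap_copyEmb (t, j)]
    rfl

end Cyclic

/-! ### Uniqueness of the maximal decomposition -/

section Unique

variable {P : Set (FinDirColHypergraph C)} {V : Type}

/-- Every decomposition of a strict hypergraph with the maximum number of parts extends to the
unique such decomposition of some `*`-join of copies. -/
theorem exists_respects_unique (hP : InducedHereditary P) [Finite V] {G : DirColHypergraph C V}
    (hG : IsStrict P G) {φ : V → Fin (dec P G)} (hφ : Function.Surjective φ)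
    (hcol : IsColoring P G φ) :
    ∃ (J : Type) (_ : Finite J) (_ : Nonempty J) (H : DirColHypergraph C (V × J)), Respects G φ H ∧
      ∀ ψ : V × J → Fin (dec P G), Function.Surjective ψ → IsColoring P H ψ →
        classes ψ = classes fun x : V × J => φ x.1 := by
  obtain ⟨J, _, H, hH, hav⟩ := exists_respects_avoiding hP (G := G) (φ := φ)
    (B := {f | Function.Surjective f ∧ ¬ ∀ x y, φ x = φ y ↔ f x = f y}) (Set.toFinite _)
    fun f hf h => hf.2 (h.ker_eq_of_prod hP hφ hf.1)
  obtain ⟨j₀, -⟩ := hav _ (hH.isColoring hP hcol)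
  have hF := hG.2
  push Not at hF
  obtain ⟨F, ⟨hF, -⟩, hFP⟩ := hF
  have hR := respects_cyclicLink (F := F) hF hH
  refine ⟨ZMod 3 × J, inferInstance, ⟨(0, j₀)⟩, cyclicLink φ H F, hR, fun ψ hψ hc => ?_⟩
  have hc0 := hc.comap hP (levelEmb V J 0)
  rw [comap_cyclicLink_levelEmb hF hH] at hc0
  obtain ⟨j, hj⟩ := hav _ hc0
  have hsurj : Function.Surjective fun v => ψ (v, ((0 : ZMod 3), j)) := by
    intro i
    obtain ⟨w, rfl⟩ := hψ i
    refine IsStrict.exists_color_eq hP (copyEmb V ((0 : ZMod 3), j)) ?_ hc w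
    rwa [hR.comap_copyEmb]
  have hker : ∀ x y, φ x = φ y ↔ ψ (x, ((0 : ZMod 3), j)) = ψ (y, ((0 : ZMod 3), j)) := by
    by_contra h
    exact hj ⟨hsurj, h⟩
  -- Three applications are needed: the last returns to level `0` and settles its copies other than
  -- `j`.
  have step : ∀ t : ZMod 3, ∀ j' : J, (∀ v, ψ (v, (t, j')) = ψ (v, ((0 : ZMod 3), j))) →
      ∀ i v, ψ (v, (t + 1, i)) = ψ (v, ((0 : ZMod 3), j)) := by
    intro t j' h i v
    rw [← h]
    refine color_succ_eq hP hG hF hFP hH hc (fun x y => ?_) v i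
    rw [h, h, hker]
  have h1 := step 0 j fun v => rfl
  have h2 := step _ j (h1 j)
  have h3 := step _ j (h2 j)
  have hall : ∀ x, ψ x = ψ (x.1, ((0 : ZMod 3), j)) := by
    rintro ⟨v, t, i⟩
    have ht : t = 0 + 1 ∨ t = 0 + 1 + 1 ∨ t = 0 + 1 + 1 + 1 := by
      revert t
      decide
    rcases ht with rfl | rfl | rfl
    exacts [h1 i v, h2 i v, h3 i v]
  refine classes_eq_of_ker hψ (hφ.comp fun v => ⟨(v, (0, j)), rfl⟩) fun x y => ?_
  rw [hall x, hall y, hker]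

end Unique

/-! ### Induced subhypergraphs of compositions and unions -/

section Comap

variable {U V W : Type}

theorem comap_comap (G : DirColHypergraph C V) (f : W ↪ V) (g : U ↪ W) :
    (G.comap f).comap g = G.comap (g.trans f) := by
  refine ext_edges fun l c => ?_
  rw [mem_comap, mem_comap, mem_comap, List.map_map]
  rfl

theorem comap_symm_comap (G : DirColHypergraph C V) (e : W ≃ V) :
    (G.comap e.toEmbedding).comap e.symm.toEmbedding = G := by
  refine ext_edges fun l c => ?_
  rw [mem_comap, mem_comap, List.map_map]
  have : ⇑e.toEmbedding ∘ ⇑e.symm.toEmbedding = id := e.self_comp_symm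
  rw [this, List.map_id]

theorem eq_of_subsingleton [Subsingleton V] (G H : DirColHypergraph C V) : G = H := by
  have : ∀ (K : DirColHypergraph C V) l c, (l, c) ∉ K.edges := by
    intro K l c h
    match l, h with
    | [], h => exact not_mem_of_length_lt (by simp) h
    | a :: l, h =>
      obtain ⟨y, -, hy⟩ := exists_ne_of_mem h a
      exact hy (Subsingleton.elim _ _)
  exact ext_edges fun l c => iff_of_false (this G l c) (this H l c)

theorem comap_inl_disjUnion₂ (G : DirColHypergraph C V) (H : DirColHypergraph C W) :
    (disjUnion₂ G H).comap Function.Embedding.inl = G := by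
  refine ext_edges fun l c => ?_
  have : (l, c) ∈ ((disjUnion₂ G H).comap Function.Embedding.inl).edges ↔
    (l.map Function.Embedding.inl, c) ∈ (G.map Function.Embedding.inl).edges ∨
    (l.map Function.Embedding.inl, c) ∈ (H.map Function.Embedding.inr).edges := Iff.rfl
  rw [this, map_mem_map]
  refine or_iff_left fun h => ?_
  obtain ⟨l', h1, h2⟩ := mem_map.1 h
  match l', h1, h2 with
  | [], h1, _ => exact not_mem_of_length_lt (by simp) h1
  | a :: l', _, h2 =>
    have : Sum.inr a ∈ l.map Sum.inl := by
      change _ ∈ l.map (Function.Embedding.inl (β := W))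
      rw [← h2]
      exact List.mem_cons_self
    simp at this

theorem comap_inr_disjUnion₂ (G : DirColHypergraph C V) (H : DirColHypergraph C W) :
    (disjUnion₂ G H).comap Function.Embedding.inr = H := by
  refine ext_edges fun l c => ?_
  have : (l, c) ∈ ((disjUnion₂ G H).comap Function.Embedding.inr).edges ↔
    (l.map Function.Embedding.inr, c) ∈ (G.map Function.Embedding.inl).edges ∨
    (l.map Function.Embedding.inr, c) ∈ (H.map Function.Embedding.inr).edges := Iff.rfl
  rw [this, map_mem_map]
  refine or_iff_right fun h => ?_
  obtain ⟨l', h1, h2⟩ := mem_map.1 h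
  match l', h1, h2 with
  | [], h1, _ => exact not_mem_of_length_lt (by simp) h1
  | a :: l', _, h2 =>
    have : Sum.inl a ∈ l.map Sum.inr := by
      change _ ∈ l.map (Function.Embedding.inr (α := V))
      rw [← h2]
      exact List.mem_cons_self
    simp at this

end Comap

/-! ### Existence and inheritance of strictness -/

section Strict

variable {P : Set (FinDirColHypergraph C)} {V W : Type}

theorem InducedHereditary.mem_of_comap_equiv (hP : InducedHereditary P) [Finite V] [Finite W]
    {G : DirColHypergraph C V} (e : W ≃ V) (h : (G.comap e.toEmbedding).toFin ∈ P) :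
    G.toFin ∈ P := by
  rw [← comap_symm_comap G e]
  exact hP.comap_mem h _

theorem InducedHereditary.mem_of_isEmpty (hP : InducedHereditary P) (hne : P.Nonempty) [Finite V]
    [IsEmpty V] (G : DirColHypergraph C V) : G.toFin ∈ P := by
  obtain ⟨H, hH⟩ := hne
  let f : V ↪ H.V := Function.Embedding.ofIsEmpty
  exact hP H hH _ ⟨f, eq_of_subsingleton G (H.graph.comap f)⟩

theorem IsStrict.of_comap [Finite V] [Finite W] {H : DirColHypergraph C W} (hP : InducedHereditary P)
    (hH : H.toFin ∈ P) (f : V ↪ W) (hG : IsStrict P (H.comap f)) : IsStrict P H := by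
  refine ⟨hH, fun hall => hG.2 ?_⟩
  rintro F ⟨hF, -⟩
  let f' : V ⊕ Unit ↪ W ⊕ Unit := f.sumMap (Function.Embedding.refl _)
  have hf' : ∀ l : List V, (l.map Sum.inl).map f' = (l.map f).map Function.Embedding.inl := by
    intro l
    rw [List.map_map, List.map_map]
    rfl
  have hF' : ∀ (l : List V) (c : C), (l.map Sum.inl, c) ∈ F.edges ↔ (l.map f, c) ∈ H.edges := by
    intro l c
    change (l, c) ∈ (F.comap Function.Embedding.inl).edges ↔ _
    rw [hF]
    rfl
  have hinl : ∀ {m : List (V ⊕ Unit)} {l : List W},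
      m.map f' = l.map Function.Embedding.inl → ∃ l' : List V, l'.map Sum.inl = m := by
    intro m l h
    refine exists_map_inl_eq fun hr => ?_
    have h1 : f' (Sum.inr ()) ∈ m.map f' := List.mem_map.2 ⟨_, hr, rfl⟩
    rw [h] at h1
    obtain ⟨w, -, hw⟩ := List.mem_map.1 h1
    exact Sum.inl_ne_inr hw
  -- Gluing `F` to `H` along `G` gives a member of `H * K₁` that induces `F`.
  let K : DirColHypergraph C (W ⊕ Unit) := (H.map Function.Embedding.inl).union (F.map f')
  have hK : K.toFin ∈ P := by
    refine hall K ⟨ext_edges fun l c => ?_, eq_of_subsingleton _ _⟩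
    rw [mem_comap, mem_union, map_mem_map]
    refine or_iff_left_of_imp fun h => ?_
    obtain ⟨m, hm, h⟩ := mem_map.1 h
    obtain ⟨l', rfl⟩ := hinl h
    rw [hf'] at h
    rw [← List.map_injective_iff.2 Function.Embedding.inl.injective h]
    exact (hF' l' c).1 hm
  have hKF : K.comap f' = F := by
    refine ext_edges fun m c => ?_
    rw [mem_comap, mem_union, map_mem_map]
    refine or_iff_right_of_imp fun h => ?_
    obtain ⟨l, hl, h⟩ := mem_map.1 h
    obtain ⟨l', rfl⟩ := hinl h.symm
    rw [hf'] at h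
    rw [List.map_injective_iff.2 Function.Embedding.inl.injective h] at hl
    exact (hF' l' c).2 hl
  rw [← hKF]
  exact hP.comap_mem hK f'

/-- Restricting a colouring to a strict subhypergraph loses no colour. -/
theorem IsStrict.dec_le [Finite V] [Finite W] {H : DirColHypergraph C W} (hP : InducedHereditary P)
    (f : V ↪ W) (hG : IsStrict P (H.comap f)) : dec P H ≤ dec P (H.comap f) := by
  refine dec_le_of_forall hP fun m φ hφ hc => ?_
  have h := (hc.comap hP f).ncard_range_le_dec hP
  have hs : Function.Surjective fun v => φ (f v) := by
    intro i
    obtain ⟨w, rfl⟩ := hφ i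
    exact hG.exists_color_eq hP f hc w
  rwa [hs.range_eq, Set.ncard_univ, Nat.card_eq_fintype_card, Fintype.card_fin] at h

/-- A property that does not contain all hypergraphs has strict members. -/
theorem exists_isStrict (hP : InducedHereditary P) (hne : P.Nonempty)
    (hF : ∃ F : FinDirColHypergraph C, F ∉ P) :
    ∃ G : FinDirColHypergraph C, IsStrict P G.graph := by
  -- For a non-member `F` with fewest vertices, `F` minus a vertex is strict, as `F` lies in its
  -- `*`-join with `K₁`.
  obtain ⟨F, hF, hmin⟩ : ∃ F : FinDirColHypergraph C, F ∉ P ∧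
      ∀ K : FinDirColHypergraph C, Nat.card K.V < Nat.card F.V → K ∈ P := by
    have hwf := (measure fun F : FinDirColHypergraph C => Nat.card F.V).wf
    obtain ⟨F, hF, hmin⟩ := hwf.has_min {F | F ∉ P} hF
    exact ⟨F, hF, fun K hK => by_contra fun h => hmin K h hK⟩
  cases isEmpty_or_nonempty F.V with
  | inl _ => exact absurd (hP.mem_of_isEmpty hne F.graph) hF
  | inr hv =>
    obtain ⟨v⟩ := hv
    classical
    let _ : Unique {x // ¬ x ≠ v} := ⟨⟨⟨v, by simp⟩⟩, fun x => Subtype.ext (not_not.1 x.2)⟩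
    let e : {x // x ≠ v} ⊕ Unit ≃ F.V :=
      ((Equiv.sumCongr (Equiv.refl _) (Equiv.ofUnique Unit {x // ¬ x ≠ v})).trans
        (Equiv.sumCompl fun x => x ≠ v))
    let f : {x // x ≠ v} ↪ F.V := Function.Embedding.subtype _
    refine ⟨(F.graph.comap f).toFin, hmin _ ?_, fun hall => hF ?_⟩
    · exact Finite.card_subtype_lt (x := v) (by simp)
    · refine hP.mem_of_comap_equiv e (hall (F.graph.comap e.toEmbedding) ⟨?_, ?_⟩)
      · exact comap_comap _ _ _
      · exact eq_of_subsingleton _ _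

end Strict

/-! ### Disjoint copies and the one-part decomposition -/

section Additive

variable {P : Set (FinDirColHypergraph C)} {V : Type}

theorem IsAdditive.copies_mem (hP : InducedHereditary P) (hadd : IsAdditive P) [Finite V]
    {G : DirColHypergraph C V} (hG : G.toFin ∈ P) (J : Type) [Finite J] :
    ((G.pull (Prod.fst : V × J → V)).sep (ConstOn Prod.snd)).toFin ∈ P := by
  refine Finite.induction_empty_option (P := fun J => ∀ _ : Finite J,
    ((G.pull (Prod.fst : V × J → V)).sep (ConstOn Prod.snd)).toFin ∈ P) ?_ ?_ ?_ J inferInstance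
  · intro α β e ih _
    have : Finite α := Finite.of_equiv β e.symm
    refine hP.mem_of_comap_equiv (Equiv.prodCongr (Equiv.refl V) e) ?_
    convert ih this using 2
    refine ext_edges fun l c => ?_
    rw [mem_comap, mem_sep, mem_sep, mem_pull, mem_pull, List.map_map, constOn_map]
    refine and_congr_right' ⟨fun h x hx y hy => e.injective (h x hx y hy), fun h => h.comp e⟩
  · exact fun _ => hP.mem_of_isEmpty ⟨_, hG⟩ _
  · intro α _ ih _
    let e : (V × α) ⊕ V ≃ V × Option α :=
      { toFun := Sum.elim (fun x => (x.1, some x.2)) fun v => (v, none)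
        invFun := fun x => x.2.elim (Sum.inr x.1) fun j => Sum.inl (x.1, j)
        left_inv := by rintro (x | v) <;> rfl
        right_inv := by rintro ⟨v, _ | j⟩ <;> rfl }
    refine hP.mem_of_comap_equiv e ?_
    have hmem := hadd _ (ih inferInstance) _ hG
    suffices h :
        ((G.pull (Prod.fst : V × Option α → V)).sep (ConstOn Prod.snd)).comap e.toEmbedding =
        disjUnion₂ ((G.pull (Prod.fst : V × α → V)).sep (ConstOn Prod.snd)) G by
      rw [h]
      exact hmem
    refine ext_edges fun l c => ?_
    rw [mem_comap, mem_sep, mem_pull, List.map_map, constOn_map]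
    constructor
    · rintro ⟨h1, h2⟩
      match l, h1, h2 with
      | [], h1, _ => exact absurd h1 (not_mem_of_length_lt (by simp))
      | Sum.inl (v, j) :: l, h1, h2 =>
        obtain ⟨l', hl'⟩ := exists_map_eq (f := (Sum.inl : V × α → (V × α) ⊕ V))
          (l := Sum.inl (v, j) :: l) fun x hx => by
            have := h2 x hx _ List.mem_cons_self
            match x, this with
            | Sum.inl x, _ => exact ⟨x, rfl⟩
        rw [← hl'] at h1 h2 ⊢
        rw [constOn_map] at h2
        rw [List.map_map] at h1
        refine Or.inl (mem_map.2 ⟨l', ⟨h1, fun x hx y hy => ?_⟩, rfl⟩)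
        exact Option.some_injective _ (h2 x hx y hy)
      | Sum.inr v :: l, h1, h2 =>
        obtain ⟨l', hl'⟩ := exists_map_eq (f := (Sum.inr : V → (V × α) ⊕ V))
          (l := Sum.inr v :: l) fun x hx => by
            have := h2 x hx _ List.mem_cons_self
            match x, this with
            | Sum.inr x, _ => exact ⟨x, rfl⟩
        rw [← hl'] at h1 ⊢
        rw [List.map_map] at h1
        refine Or.inr (mem_map.2 ⟨l', ?_, rfl⟩)
        rwa [← List.map_id l']
    · rintro (h | h)
      · obtain ⟨l', ⟨h1, h2⟩, rfl⟩ := mem_map.1 h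
        rw [List.map_map, constOn_map]
        exact ⟨h1, h2.comp some⟩
      · obtain ⟨l', h1, rfl⟩ := mem_map.1 h
        rw [List.map_map, constOn_map]
        refine ⟨?_, fun _ _ _ _ => rfl⟩
        rwa [← List.map_id l'] at h1

/-- Additivity makes the constant map a colouring, so the supremum defining `dec` runs over a
non-empty set and is attained. -/
theorem IsAdditive.exists_isDecompositionWith_dec (hP : InducedHereditary P) (hadd : IsAdditive P)
    [Finite V] {G : DirColHypergraph C V} (hG : G.toFin ∈ P) :
    ∃ d, IsDecompositionWith P G (dec P G) d := by
  have hc : IsColoring P G fun _ => () := by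
    intro J _ K hK
    convert hadd.copies_mem hP hG J using 2
    refine ext_edges fun l c => ?_
    rw [hK l c fun _ _ _ _ => rfl, and_comm]
    rfl
  exact DirColHypergraph.exists_isDecompositionWith_dec hP
    ⟨_, hc.exists_isDecompositionWith hP⟩

end Additive

/-! ### The two halves of the theorem -/

section Main

variable {P : Set (FinDirColHypergraph C)} {V : Type}

theorem classes_comp {W ι : Type} (φ : V → ι) (f : W → V) :
    classes (fun x => φ (f x)) = (fun U => f ⁻¹' U) '' classes φ := by
  rw [classes, classes, ← Set.range_comp]
  rfl

theorem exists_starPower_unique (hP : InducedHereditary P) [Finite V] {G : DirColHypergraph C V}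
    (hG : IsStrict P G) {d₀ : Set (Set V)} (hd₀ : IsDecompositionWith P G (dec P G) d₀) :
    ∃ s : ℕ, 0 < s ∧ ∃ Gs ∈ starPower s G, IsStrict P Gs ∧
      ∃ d, IsDecompositionWith P Gs (dec P G) d ∧
        (∀ d', IsDecompositionWith P Gs (dec P G) d' → d' = d) ∧
        ∀ j : Fin s, restrictCopy d j = d₀ := by
  obtain ⟨φ, hφ, hcol, rfl⟩ := (isDecompositionWith_iff hP).1 hd₀
  obtain ⟨J, _, _, H, hH, huniq⟩ := exists_respects_unique hP hG hφ hcol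
  -- The copies, indexed by an arbitrary finite type so far, are renumbered to match `starPower`.
  let e := Finite.equivFin J
  let σ : (Σ _ : Fin (Nat.card J), V) ≃ V × J :=
    { toFun := fun x => (x.2, e.symm x.1)
      invFun := fun x => ⟨e x.2, x.1⟩
      left_inv := fun x => by simp
      right_inv := fun x => by simp }
  have hpos : 0 < Nat.card J := Nat.card_pos
  have hmem : H.comap σ.toEmbedding ∈ starPower (Nat.card J) G := by
    intro i
    rw [comap_comap]
    exact hH.comap_copyEmb (e.symm i)
  have hc : IsColoring P (H.comap σ.toEmbedding) fun x => φ x.2 :=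
    (hH.isColoring hP hcol).comap hP σ.toEmbedding
  have hs : Function.Surjective fun x : Σ _ : Fin (Nat.card J), V => φ x.2 := fun i => by
    obtain ⟨v, rfl⟩ := hφ i
    exact ⟨⟨⟨0, hpos⟩, v⟩, rfl⟩
  refine ⟨Nat.card J, hpos, _, hmem, ?_, classes fun x => φ x.2,
    (isDecompositionWith_iff hP).2 ⟨_, hs, hc, rfl⟩, ?_, fun j => ?_⟩
  · refine IsStrict.of_comap hP (hc.self_mem hP) (Function.Embedding.sigmaMk ⟨0, hpos⟩) ?_
    rwa [hmem]
  · intro d' hd'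
    obtain ⟨ψ, hψ, hψc, rfl⟩ := (isDecompositionWith_iff hP).1 hd'
    have hψc' := hψc.comap hP σ.symm.toEmbedding
    rw [comap_symm_comap] at hψc'
    have := huniq _ (hψ.comp σ.symm.surjective) hψc'
    have h2 : classes (fun x => (ψ ∘ σ.symm) (σ x)) = classes (fun x => φ (σ x).1) := by
      rw [classes_comp (ψ ∘ σ.symm) σ, this, ← classes_comp]
    have h3 : ∀ x, (ψ ∘ σ.symm) (σ x) = ψ x := fun x => congrArg ψ (σ.symm_apply_apply x)
    simp only [h3] at h2
    exact h2
  · ext U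
    constructor
    · rintro ⟨-, _, ⟨i, rfl⟩, rfl⟩
      exact ⟨i, rfl⟩
    · rintro ⟨i, rfl⟩
      exact ⟨hφ i, _, ⟨i, rfl⟩, rfl⟩

theorem exists_mem_strictUnique (hP : InducedHereditary P) (hadd : IsAdditive P)
    (hF : ∃ F : FinDirColHypergraph C, F ∉ P) {G : FinDirColHypergraph C} (hG : G ∈ P) :
    ∃ H ∈ strictUnique P, G.graph.IsInducedSub H.graph := by
  obtain ⟨G₁, hG₁, hdec⟩ : ∃ G : FinDirColHypergraph C, IsStrict P G.graph ∧
      dec P G.graph = decNumber P := by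
    obtain ⟨G₁, hG₁⟩ := exists_isStrict hP ⟨G, hG⟩ hF
    exact Nat.sInf_mem (s := {n | ∃ G : FinDirColHypergraph C, IsStrict P G.graph ∧
      dec P G.graph = n}) ⟨_, G₁, hG₁, rfl⟩
  have hmin : ∀ {W : Type} [Finite W] {H : DirColHypergraph C W}, IsStrict P H →
      decNumber P ≤ dec P H := fun {W} _ {H} hH => Nat.sInf_le ⟨H.toFin, hH, rfl⟩
  -- `G` provides the embedding, while `G₁` provides strictness and the upper bound on `dec`; the
  -- lower bound is the minimality of `decNumber P`.
  let U := disjUnion₂ G.graph G₁.graph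
  have hUmem : U.toFin ∈ P := hadd G hG G₁ hG₁.1
  have hcomap : IsStrict P (U.comap Function.Embedding.inr) := by
    rwa [comap_inr_disjUnion₂]
  have hU : IsStrict P U := hcomap.of_comap hP hUmem
  have hUdec : dec P U = decNumber P := by
    refine le_antisymm ?_ (hmin hU)
    have := hcomap.dec_le hP
    rwa [comap_inr_disjUnion₂, hdec] at this
  obtain ⟨d₀, hd₀⟩ := hadd.exists_isDecompositionWith_dec hP hUmem
  obtain ⟨s, hs, Gs, hGs, hstrict, d, hd, hduniq, -⟩ := exists_starPower_unique hP hU hd₀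
  have hemb := hGs ⟨0, hs⟩
  have hGsdec : dec P Gs = decNumber P := by
    refine le_antisymm ?_ (hmin hstrict)
    have := IsStrict.dec_le (H := Gs) hP (Function.Embedding.sigmaMk (⟨0, hs⟩ : Fin s))
      (by rwa [hemb])
    rwa [hemb, hUdec] at this
  let f : G.V ⊕ G₁.V ↪ Σ _ : Fin s, G.V ⊕ G₁.V :=
    Function.Embedding.sigmaMk (β := fun _ => G.V ⊕ G₁.V) ⟨0, hs⟩
  refine ⟨Gs.toFin, ⟨hstrict, ?_, hGsdec⟩, Function.Embedding.inl.trans f, ?_⟩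
  · rw [hUdec, ← hGsdec] at hd hduniq
    exact ⟨d, hd, hduniq⟩
  · refine Eq.trans ?_ (comap_comap Gs f Function.Embedding.inl)
    exact (comap_inl_disjUnion₂ G.graph G₁.graph).symm.trans (congrArg _ hemb.symm)

end Main

end DirColHypergraph

theorem mainTheorem6 {C : Type*} (P : Set (FinDirColHypergraph C))
    (hP : DirColHypergraph.IsProperty P) (hher : DirColHypergraph.InducedHereditary P)
    (hadd : DirColHypergraph.IsAdditive P) :
    (∀ (V : Type) [Finite V] (G : DirColHypergraph C V) (n : ℕ) (d₀ : Set (Set V)),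
      DirColHypergraph.IsStrict P G → DirColHypergraph.dec P G = n →
      DirColHypergraph.IsDecompositionWith P G n d₀ →
      ∃ s : ℕ, 0 < s ∧ ∃ Gs ∈ DirColHypergraph.starPower s G,
        DirColHypergraph.IsStrict P Gs ∧
        ∃ d, DirColHypergraph.IsDecompositionWith P Gs n d ∧
          (∀ d', DirColHypergraph.IsDecompositionWith P Gs n d' → d' = d) ∧
          ∀ j : Fin s, DirColHypergraph.restrictCopy d j = d₀) ∧
    ((∃ F : FinDirColHypergraph C, F ∉ P) →
      DirColHypergraph.generated (DirColHypergraph.strictUnique P) = P) := by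
  refine ⟨?_, fun hF => Set.Subset.antisymm ?_ ?_⟩
  · rintro V _ G n d₀ hG rfl hd₀
    exact DirColHypergraph.exists_starPower_unique hher hG hd₀
  · exact Set.sInter_subset_of_mem ⟨hP, hher, fun G hG => hG.1.1⟩
  · rintro G hG Q ⟨-, hQ, hsub⟩
    obtain ⟨H, hH, hGH⟩ := DirColHypergraph.exists_mem_strictUnique hher hadd hF hG
    exact hQ H (hsub hH) G hGH
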